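/- Let $\mathbb{K}$ be a field of characteristic zero, $n\ge 0$, and $S=\mathbb{K}[x_1,\dots,x_n]$. Let $\mathbf{u}=(u_1,\dots,u_n)\in\mathbb{Z}_{>0}^n$ and $\mathbf{v}=(v_1,\dots,v_n)\in\mathbb{Z}^n$. Grade $S$ by giving $x_i$ degree $u_i$, and grade the module $\mathrm{Der}_{\mathbb{K}}(S)$ of $\mathbb{K}$-linear derivations of $S$ by giving $a\,\partial_i$ degree $\deg^{\mathbf u}(a)+v_i$ for $a\in S$ $\mathbf{u}$-homogeneous, where $\partial_i=\partial/\partial x_i$; write $D^{(\mathbf{u},\mathbf{v})}$ for this graded $S$-module. For a nonzero $Q\in S$ with factorization into irreducibles $Q=c\,Q_1^{e_1}\cdots Q_r^{e_r}$ ($c\in\mathbb{K}^*$, the $Q_i$ pairwise non-associated), let $$D(Q)=\bigcap_{i=1}^r\{\delta\in \mathrm{Der}_{\mathbb{K}}(S)\mid \delta(Q_i)\in Q_i^{e_i}S\}$$ be its (generalized) logarithmic derivation module. For a graded submodule $M\subseteq D^{(\mathbf{u},\mathbf{v})}$ with finite-dimensional homogeneous parts $M_j$ let $HP_M(t)=\sum_{j\in\mathbb{Z}}(\dim_{\mathbb{K}}M_j)\,t^j$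 be its Hilbert–Poincaré series and, when $\prod_{i=1}^n(1-t^{u_i})\,HP_M(t)$ is a Laurent polynomial, put $$\chi(M)=\Big[\prod_{i=1}^n(1-t^{u_i})\,HP_M(t)\Big]'(1)\in\mathbb{Z}.$$ **Theorem.** Let $Q\in S$ be a nonzero $\mathbf{u}$-homogeneous polynomial, and suppose that $D(Q)$ is a graded submodule of $D^{(\mathbf{u},\mathbf{v})}$, i.e. the homogeneous parts of each element of $D(Q)$ are again in $D(Q)$. Write $D^{(\mathbf{u},\mathbf{v})}(Q)$ for $D(Q)$ with this grading. Then all homogeneous parts of $D^{(\mathbf{u},\mathbf{v})}(Q)$ are finite-dimensional over $\mathbb{K}$, the series $\prod_{i=1}^n(1-t^{u_i})\,HP_{D^{(\mathbf{u},\mathbf{v})}(Q)}(t)$ is a Laurent polynomial in $t$ with integer coefficients, and $$\chi\big(D^{(\mathbf{u},\mathbf{v})}(Q)\big)=\deg^{\mathbf{u}}(Q)+|\mathbf{v}|,\qquad |\mathbf{v}|=v_1+\cdots+v_n .$$ -/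

import Mathlib

noncomputable section

namespace LogDer

open MvPolynomial

variable {K : Type*} [Field K] {n : ℕ}

/-- The module `Der_K(S)` of `K`-linear derivations of `S = K[x_1, …, x_n]`. -/
abbrev Der (K : Type*) [Field K] (n : ℕ) : Type _ :=
  Derivation K (MvPolynomial (Fin n) K) (MvPolynomial (Fin n) K)

/-- `D(g; k) = {δ | ∃ h ∈ S, δ(g) = h g ^ k}`. -/
def logDerPow (g : MvPolynomial (Fin n) K) (k : ℕ) :
    Submodule (MvPolynomial (Fin n) K) (Der K n) where
  carrier := {δ | ∃ h : MvPolynomial (Fin n) K, δ g = h * g ^ k}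
  zero_mem' := ⟨0, by simp⟩
  add_mem' := by
    rintro δ ε ⟨a, ha⟩ ⟨b, hb⟩
    exact ⟨a + b, by rw [Derivation.add_apply, ha, hb, add_mul]⟩
  smul_mem' := by
    rintro c δ ⟨a, ha⟩
    exact ⟨c * a, by rw [Derivation.smul_apply, ha, smul_eq_mul, mul_assoc]⟩

/-- The generalized logarithmic derivation module `D(f) = ⋂ D(f_i; e_i)` of
`f = f_1 ^ e_1 ⋯ f_r ^ e_r`: the intersection is over all irreducible divisors `p` of `f`,
and the exponent is the multiplicity of `p` in `f`. (Associated irreducible divisors differ by a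
nonzero constant and give the same module `D(p; e)`.) -/
def logDer (f : MvPolynomial (Fin n) K) : Submodule (MvPolynomial (Fin n) K) (Der K n) :=
  ⨅ (p : MvPolynomial (Fin n) K) (_ : Irreducible p) (_ : p ∣ f), logDerPow p (multiplicity p f)

/-- The degree-`j` part of `Der_K(S)` for the grading in which `x_i` has degree `u_i` and `∂_i`
has degree `v_i`: the derivations `∑ a_i ∂_i` with every `a_i = δ(x_i)` zero or `u`-homogeneous of
degree `j - v_i`. -/
def derDegree (u : Fin n → ℕ) (v : Fin n → ℤ) (j : ℤ) : Submodule K (Der K n) where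
  carrier := {δ | ∀ i, IsWeightedHomogeneous (fun l => (u l : ℤ)) (δ (X i)) (j - v i)}
  zero_mem' := fun _ => isWeightedHomogeneous_zero K _ _
  add_mem' := fun ha hb i => (ha i).add (hb i)
  smul_mem' := fun c _ ha i =>
    (weightedHomogeneousSubmodule K (fun l => (u l : ℤ)) _).smul_mem c (ha i)

/-- The homogeneous part of degree `j` of a derivation `δ = ∑ a_i ∂_i`: the coefficient of `∂_i`
is the `u`-homogeneous part of `a_i` of degree `j - v_i`. -/
def homPart (u : Fin n → ℕ) (v : Fin n → ℤ) (j : ℤ) (δ : Der K n) : Der K n :=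
  mkDerivation K fun i =>
    weightedHomogeneousComponent (fun l => (u l : ℤ)) (j - v i) (δ (X i))

/-- `M` is a graded submodule of `Der_K(S)` for the `(u, v)`-grading: the homogeneous parts of the
elements of `M` are in `M`. -/
def IsGraded (u : Fin n → ℕ) (v : Fin n → ℤ)
    (M : Submodule (MvPolynomial (Fin n) K) (Der K n)) : Prop :=
  ∀ δ ∈ M, ∀ j : ℤ, homPart u v j δ ∈ M

/-- The homogeneous part `M_j` of a graded submodule `M` of `Der_K(S)`. -/
def gradedPart (u : Fin n → ℕ) (v : Fin n → ℤ)
    (M : Submodule (MvPolynomial (Fin n) K) (Der K n)) (j : ℤ) : Submodule K (Der K n) :=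
  M.restrictScalars K ⊓ derDegree u v j

theorem derDegree_eq_bot (u : Fin n → ℕ) (v : Fin n → ℤ) {j : ℤ} (hj : j < -∑ i, |v i|) :
    (derDegree u v j : Submodule K (Der K n)) = ⊥ := by
  rw [eq_bot_iff]
  intro δ hδ
  rw [Submodule.mem_bot]
  refine derivation_ext fun i => ?_
  rw [Derivation.zero_apply]
  by_contra h
  obtain ⟨m, hm⟩ := ne_zero_iff.mp h
  have h1 : Finsupp.weight (fun l => (u l : ℤ)) m = j - v i := hδ i hm
  have h2 : 0 ≤ Finsupp.weight (fun l => (u l : ℤ)) m := by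
    rw [Finsupp.weight_apply]
    exact Finsupp.sum_nonneg' fun l => by positivity
  have h3 : |v i| ≤ ∑ i, |v i| :=
    Finset.single_le_sum (f := fun i => |v i|) (fun _ _ => abs_nonneg _) (Finset.mem_univ i)
  have h4 := neg_abs_le (v i)
  omega

/-- The Hilbert–Poincaré series `HP_M(t) = ∑ (dim_K M_j) t ^ j`, a formal Laurent series. -/
def hilbertPoincare (u : Fin n → ℕ) (v : Fin n → ℤ)
    (M : Submodule (MvPolynomial (Fin n) K) (Der K n)) : LaurentSeries ℤ :=
  HahnSeries.ofSuppBddBelow (fun j => (Module.finrank K (gradedPart u v M j) : ℤ)) <| by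
    refine ⟨-∑ i, |v i|, fun j hj => ?_⟩
    by_contra! h
    refine hj ?_
    have : gradedPart u v M j = ⊥ := by
      rw [gradedPart, derDegree_eq_bot u v h, inf_bot_eq]
    change (Module.finrank K (gradedPart u v M j) : ℤ) = 0
    rw [this, finrank_bot, Nat.cast_zero]

/-- `∏ (1 - t ^ u_i) · HP_M(t)`. -/
def hilbertNumerator (u : Fin n → ℕ) (v : Fin n → ℤ)
    (M : Submodule (MvPolynomial (Fin n) K) (Der K n)) : LaurentSeries ℤ :=
  (∏ i, (1 - HahnSeries.single (u i : ℤ) (1 : ℤ))) * hilbertPoincare u v M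

/-- The invariant `χ(M) = [∏ (1 - t ^ u_i) · HP_M(t)]'(1)`: the derivative of the numerator,
evaluated at `t = 1` by summing its coefficients. This is meaningful when the numerator is a
Laurent polynomial, that is, has only finitely many nonzero coefficients. -/
def chi (u : Fin n → ℕ) (v : Fin n → ℤ)
    (M : Submodule (MvPolynomial (Fin n) K) (Der K n)) : ℤ :=
  ∑ᶠ j : ℤ, (LaurentSeries.derivative ℤ (hilbertNumerator u v M)).coeff j

end LogDer

end

/-! ### Laurent series with nonnegative coefficients and their values at `t = 1`. -/

namespace LogDer

open HahnSeries Filter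

/-! Write `Q = ∏ p ^ e_p` up to a constant. The `S`-linear map `Ψ(δ) = ∑ (Q / p ^ e_p) δ(p)`
satisfies `D(Q) = Ψ⁻¹(QS)`, because modulo `p ^ e_p` only the term of `p` survives. Hence `Ψ` embeds
`Der/D(Q)` in `S/QS`. In characteristic zero some `θ` has `Ψ(θ)` relatively prime to `Q`, and then
`g ↦ gθ` embeds `S/QS` in `Der/D(Q)` (`exists_linearMap_mem_logDer_iff`).

These embeddings are not homogeneous, but each raises degrees by a bounded amount. So the dimension
of the degree `≤ k` part of `Der/D(Q)` lies between those of `S/QS` at `k - a` and at `k + b`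
(`exists_coeff_filtSeries_bounds`). The numerator of `S/QS` is `1 - t ^ d`, with value `0` and
derivative `-d` at `t = 1`. As the value is `0`, multiplying by a power of `t` does not change the
derivative, and the unknown shifts do no harm: the two inequalities force the numerator of
`Der/D(Q)` to have value `0` and derivative `-d` too (`HasValues.nonneg`). The numerator of `Der` is
`∑ t ^ v_i`, with derivative `|v|`, so `χ(D(Q)) = |v| + d`.

The numerator is a Laurent polynomial by the Hilbert–Serre argument, an induction on the variables
(`finite_support_prod_mul_sub`). -/

/-- The Laurent series `1 / (1 - t)`. -/
noncomputable def geom : LaurentSeries ℤ :=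
  ofSuppBddBelow (fun k => if 0 ≤ k then 1 else 0) ⟨0, fun k hk => by
    by_contra h
    exact hk (if_neg h)⟩

/-- The Laurent series `1 / (1 - t) ^ 2`. -/
noncomputable def geomSq : LaurentSeries ℤ :=
  ofSuppBddBelow (fun k => if 0 ≤ k then k + 1 else 0) ⟨0, fun k hk => by
    by_contra h
    exact hk (if_neg h)⟩

theorem coeff_geom (k : ℤ) : geom.coeff k = if 0 ≤ k then 1 else 0 := rfl

theorem coeff_geomSq (k : ℤ) : geomSq.coeff k = if 0 ≤ k then k + 1 else 0 := rfl

theorem coeff_one_sub_single_mul (a : ℤ) (x : LaurentSeries ℤ) (k : ℤ) :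
    ((1 - single a (1 : ℤ)) * x).coeff k = x.coeff k - x.coeff (k - a) := by
  rw [sub_mul, one_mul, coeff_sub, coeff_single_mul, one_mul]

theorem one_sub_mul_geomSq : (1 - single (1 : ℤ) (1 : ℤ)) * geomSq = geom := by
  ext k
  rw [coeff_one_sub_single_mul, coeff_geomSq, coeff_geomSq, coeff_geom]
  split_ifs <;> omega

theorem coeff_mul_nonneg {x y : LaurentSeries ℤ} (hx : ∀ k, 0 ≤ x.coeff k)
    (hy : ∀ k, 0 ≤ y.coeff k) (k : ℤ) : 0 ≤ (x * y).coeff k := by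
  rw [coeff_mul]
  exact Finset.sum_nonneg fun i _ => mul_nonneg (hx _) (hy _)

/-- Along each residue class modulo `a` the integer coefficients of `z` eventually drop by at least
`1` at each step, hence become negative. This replaces any analysis of the pole at `t = 1`. -/
theorem eventually_coeff_neg_of_one_sub_single_mul {a : ℤ} (ha : 0 < a) {z : LaurentSeries ℤ}
    (h : ∀ᶠ k in atTop, ((1 - single a (1 : ℤ)) * z).coeff k < 0) :
    ∀ᶠ k in atTop, z.coeff k < 0 := by
  simp only [coeff_one_sub_single_mul] at h
  obtain ⟨J, hJ⟩ := eventually_atTop.mp h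
  -- `C` bounds `z` on a full period just before `J`; after `m` further periods the bound is `C -
  -- m`.
  set C : ℤ := ∑ j ∈ Finset.Ico (J - a) J, |z.coeff j| with hC
  have key (m : ℕ) : ∀ j, J - a + m * a ≤ j → j < J + m * a → z.coeff j ≤ C - m := by
    induction m with
    | zero =>
      intro j h1 h2
      have h3 : |z.coeff j| ≤ C :=
        Finset.single_le_sum (f := fun j => |z.coeff j|) (fun _ _ => abs_nonneg _)
          (Finset.mem_Ico.mpr ⟨by simpa using h1, by simpa using h2⟩)
      simpa using (le_abs_self _).trans h3
    | succ m ih =>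
      intro j h1 h2
      push_cast at h1 h2 ⊢
      have h3 := ih (j - a) (by linarith) (by linarith)
      have h4 := hJ j (by nlinarith)
      linarith
  have hC0 : 0 ≤ C := Finset.sum_nonneg fun _ _ => abs_nonneg _
  -- From here on at least `C + 1` whole periods have passed, so the bound `C - m` is at most `-1`.
  refine eventually_atTop.mpr ⟨J - a + (C + 1) * a, fun j hj => ?_⟩
  have h0 : C + 1 ≤ (j - (J - a)) / a := (Int.le_ediv_iff_mul_le ha).mpr (by linarith)
  obtain ⟨m, hm⟩ := Int.eq_ofNat_of_zero_le (show 0 ≤ (j - (J - a)) / a by linarith)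
  have h1 := Int.ediv_mul_le (j - (J - a)) ha.ne'
  have h2 := Int.lt_ediv_add_one_mul_self (j - (J - a)) ha
  rw [hm] at h0 h1 h2
  have := key m j (by linarith) (by linarith)
  linarith

theorem eventually_coeff_neg_of_prod_mul {ι : Type*} (u : ι → ℤ) (hu : ∀ i, 0 < u i)
    (s : Finset ι) {z : LaurentSeries ℤ}
    (h : ∀ᶠ k in atTop, ((∏ i ∈ s, (1 - single (u i) (1 : ℤ))) * z).coeff k < 0) :
    ∀ᶠ k in atTop, z.coeff k < 0 := by
  classical
  induction s using Finset.induction_on with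
  | empty => simpa using h
  | insert i s hi ih =>
    rw [Finset.prod_insert hi, mul_assoc] at h
    exact ih (eventually_coeff_neg_of_one_sub_single_mul (hu i) h)

/-- The coefficients of `w / (1 - t) ^ 2` are eventually `a (k + 1) - b`. For a Laurent
polynomial `w` this holds with `a = w(1)` and `b = w'(1)`. -/
def HasValues (w : LaurentSeries ℤ) (a b : ℤ) : Prop :=
  ∀ᶠ k in atTop, (w * geomSq).coeff k = a * (k + 1) - b

theorem HasValues.add {w₁ w₂ : LaurentSeries ℤ} {a₁ b₁ a₂ b₂ : ℤ} (h₁ : HasValues w₁ a₁ b₁)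
    (h₂ : HasValues w₂ a₂ b₂) : HasValues (w₁ + w₂) (a₁ + a₂) (b₁ + b₂) := by
  filter_upwards [h₁, h₂] with k h₁ h₂
  rw [add_mul, coeff_add, h₁, h₂]
  ring

theorem HasValues.neg {w : LaurentSeries ℤ} {a b : ℤ} (h : HasValues w a b) :
    HasValues (-w) (-a) (-b) := by
  filter_upwards [h] with k h
  rw [neg_mul, coeff_neg, h]
  ring

theorem HasValues.sub {w₁ w₂ : LaurentSeries ℤ} {a₁ b₁ a₂ b₂ : ℤ} (h₁ : HasValues w₁ a₁ b₁)
    (h₂ : HasValues w₂ a₂ b₂) : HasValues (w₁ - w₂) (a₁ - a₂) (b₁ - b₂) := by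
  simpa only [sub_eq_add_neg] using h₁.add h₂.neg

theorem hasValues_single (j c : ℤ) : HasValues (single j c) c (j * c) := by
  filter_upwards [eventually_ge_atTop j] with k hk
  rw [coeff_single_mul, coeff_geomSq, if_pos (by omega)]
  ring

theorem HasValues.sum {ι : Type*} (s : Finset ι) {w : ι → LaurentSeries ℤ} {a b : ι → ℤ}
    (h : ∀ i ∈ s, HasValues (w i) (a i) (b i)) :
    HasValues (∑ i ∈ s, w i) (∑ i ∈ s, a i) (∑ i ∈ s, b i) := by
  classical
  induction s using Finset.induction_on with
  | empty => exact Eventually.of_forall fun k => by simp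
  | insert i s hi ih =>
    rw [Finset.sum_insert hi, Finset.sum_insert hi, Finset.sum_insert hi]
    exact (h i (Finset.mem_insert_self i s)).add
      (ih fun j hj => h j (Finset.mem_insert_of_mem hj))

theorem hasValues_of_finite_support {w : LaurentSeries ℤ} (hw : w.coeff.support.Finite) :
    HasValues w (∑ᶠ j, w.coeff j) (∑ᶠ j, j * w.coeff j) := by
  have h : w = ∑ j ∈ hw.toFinset, single j (w.coeff j) := by
    ext k
    rw [coeff_sum]
    by_cases hk : w.coeff k = 0
    · rw [hk, Finset.sum_eq_zero fun j hj => coeff_single_of_ne ?_]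
      rintro rfl
      exact hw.mem_toFinset.mp hj hk
    · rw [Finset.sum_eq_single k (fun j _ hj => coeff_single_of_ne hj.symm)
        (fun h => absurd (hw.mem_toFinset.mpr hk) h), coeff_single_same]
  rw [finsum_eq_sum_of_support_subset (s := hw.toFinset) _ (by simp),
    finsum_eq_sum_of_support_subset (s := hw.toFinset) _ (fun j hj => by
      simpa using right_ne_zero_of_mul hj)]
  have := HasValues.sum hw.toFinset (fun j _ => hasValues_single j (w.coeff j))
  rwa [← h] at this

/-- Here `w / (1 - t) ^ 2 = ∏ (1 - t ^ u_i) · x / (1 - t)`. If its coefficients `a (k + 1) - b` were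
eventually negative, so would be those of `x / (1 - t)`, which are nonnegative. -/
theorem HasValues.nonneg {ι : Type*} [Fintype ι] (u : ι → ℤ) (hu : ∀ i, 0 < u i)
    {x w : LaurentSeries ℤ} (hx : ∀ k, 0 ≤ x.coeff k)
    (hw : (1 - single (1 : ℤ) (1 : ℤ)) * ((∏ i, (1 - single (u i) (1 : ℤ))) * x) = w)
    {a b : ℤ} (h : HasValues w a b) : 0 ≤ a ∧ (a = 0 → b ≤ 0) := by
  have key : ¬ ∀ᶠ k in atTop, (w * geomSq).coeff k < 0 := by
    intro h
    have h1 : w * geomSq = (∏ i, (1 - single (u i) (1 : ℤ))) * (x * geom) := by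
      rw [← hw, ← one_sub_mul_geomSq]
      ring
    rw [h1] at h
    obtain ⟨k, hk⟩ := (eventually_coeff_neg_of_prod_mul u hu _ h).exists
    exact absurd hk (not_lt.mpr (coeff_mul_nonneg hx
      (fun j => by rw [coeff_geom]; split_ifs <;> simp) k))
  constructor
  · by_contra! ha
    refine key ?_
    filter_upwards [h, eventually_gt_atTop |b|] with k hk hb
    rw [hk]
    have := neg_abs_le b
    have := abs_nonneg b
    nlinarith
  · intro ha
    by_contra! hb
    refine key ?_
    filter_upwards [h] with k hk
    rw [hk, ha]
    linarith

end LogDer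

/-! ### Counting monomials and polynomials by weighted degree. -/

noncomputable section
namespace LogDer

open MvPolynomial HahnSeries

variable {K : Type*} [Field K] {n : ℕ}

/-- The `u`-degree of a monomial, as an integer. -/
abbrev wt (u : Fin n → ℕ) : (Fin n →₀ ℕ) →+ ℤ := Finsupp.weight fun l => (u l : ℤ)

theorem wt_eq (u : Fin n → ℕ) (m : Fin n →₀ ℕ) : wt u m = (Finsupp.weight u m : ℕ) := by
  simp [Finsupp.weight_eq_sum]

theorem wt_nonneg (u : Fin n → ℕ) (m : Fin n →₀ ℕ) : 0 ≤ wt u m := by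
  rw [wt_eq]
  positivity

theorem finite_wt_le {u : Fin n → ℕ} (hu : ∀ i, 0 < u i) (k : ℤ) : {m | wt u m ≤ k}.Finite :=
  (Finsupp.finite_of_nat_weight_le u (fun i => (hu i).ne') k.toNat).subset fun m hm => by
    have h : wt u m ≤ k := hm
    rw [wt_eq] at h
    change Finsupp.weight u m ≤ k.toNat
    omega

theorem finite_wt_eq {u : Fin n → ℕ} (hu : ∀ i, 0 < u i) (k : ℤ) : {m | wt u m = k}.Finite :=
  (finite_wt_le hu k).subset fun _ hm => le_of_eq hm

/-- The generating series of a family of sets of monomials, empty in negative degrees. -/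
def countSeries (s : ℤ → Set (Fin n →₀ ℕ)) (hs : ∀ k < 0, s k = ∅) : LaurentSeries ℤ :=
  ofSuppBddBelow (fun k => ((s k).ncard : ℤ)) ⟨0, fun k hk => by
    by_contra! h
    exact hk (by simp [hs k h])⟩

theorem coeff_countSeries {s : ℤ → Set (Fin n →₀ ℕ)} (hs : ∀ k < 0, s k = ∅) (k : ℤ) :
    (countSeries s hs).coeff k = (s k).ncard := rfl

theorem setOf_wt_eq_of_neg (u : Fin n → ℕ) (A : Finset (Fin n)) :
    ∀ k < 0, {m | m.support ⊆ A ∧ wt u m = k} = ∅ := by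
  intro k hk
  ext m
  have := wt_nonneg u m
  simp only [Set.mem_ofPred_eq, Set.mem_empty_iff_false, iff_false]
  omega

theorem setOf_wt_le_of_neg (u : Fin n → ℕ) : ∀ k < 0, {m | wt u m ≤ k} = ∅ := by
  intro k hk
  ext m
  have := wt_nonneg u m
  simp only [Set.mem_ofPred_eq, Set.mem_empty_iff_false, iff_false]
  omega

/-- A monomial in the variables of `insert a A` either avoids `x_a` or is `x_a` times another such
monomial. -/
theorem ncard_setOf_support_subset_insert {u : Fin n → ℕ} (hu : ∀ i, 0 < u i)
    {A : Finset (Fin n)} {a : Fin n} (ha : a ∉ A) (k : ℤ) :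
    {m : Fin n →₀ ℕ | m.support ⊆ insert a A ∧ wt u m = k}.ncard =
      {m : Fin n →₀ ℕ | m.support ⊆ A ∧ wt u m = k}.ncard +
        {m : Fin n →₀ ℕ | m.support ⊆ insert a A ∧ wt u m = k - u a}.ncard := by
  have hf (B : Finset (Fin n)) (j : ℤ) : {m : Fin n →₀ ℕ | m.support ⊆ B ∧ wt u m = j}.Finite :=
    (finite_wt_eq hu j).subset fun m hm => hm.2
  have hwt : wt u (Finsupp.single a 1) = u a := by simp [Finsupp.weight_single]
  have hinj : Function.Injective fun m : Fin n →₀ ℕ => m + Finsupp.single a 1 :=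
    add_left_injective _
  rw [← Set.ncard_image_of_injective {m | m.support ⊆ insert a A ∧ wt u m = k - u a} hinj,
    ← Set.ncard_union_eq _ (hf _ _) ((hf _ _).image _)]
  · congr 1
    ext m
    simp only [Set.mem_ofPred_eq, Set.mem_union, Set.mem_image]
    constructor
    · rintro ⟨h1, h2⟩
      by_cases hm : a ∈ m.support
      · right
        have h3 : m - Finsupp.single a 1 + Finsupp.single a 1 = m :=
          Finsupp.sub_add_single_one_cancel (Finsupp.mem_support_iff.mp hm)
        refine ⟨m - Finsupp.single a 1, ⟨fun i hi => h1 ?_, ?_⟩, h3⟩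
        · rw [Finsupp.mem_support_iff] at hi ⊢
          rw [Finsupp.tsub_apply] at hi
          omega
        · have := congrArg (wt u) h3
          rw [map_add, hwt] at this
          omega
      · left
        exact ⟨(Finset.subset_insert_iff_of_notMem hm).mp h1, h2⟩
    · rintro (⟨h1, h2⟩ | ⟨m, ⟨h1, h2⟩, rfl⟩)
      · exact ⟨h1.trans (Finset.subset_insert _ _), h2⟩
      · refine ⟨Finsupp.support_add.trans (Finset.union_subset h1 ?_), ?_⟩
        · exact Finsupp.support_single_subset.trans (by simp)
        · rw [map_add, hwt, h2]
          ring
  · rw [Set.disjoint_left]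
    rintro _ ⟨h1, -⟩ ⟨m, -, rfl⟩
    exact ha (h1 (by simp))

theorem prod_mul_countSeries {u : Fin n → ℕ} (hu : ∀ i, 0 < u i) (A : Finset (Fin n)) :
    (∏ i ∈ A, (1 - single (u i : ℤ) (1 : ℤ))) *
      countSeries (fun k => {m | m.support ⊆ A ∧ wt u m = k}) (setOf_wt_eq_of_neg u A) = 1 := by
  induction A using Finset.induction_on with
  | empty =>
    ext k
    rw [Finset.prod_empty, one_mul, coeff_countSeries, HahnSeries.coeff_one]
    split_ifs with hk
    · rw [show {m : Fin n →₀ ℕ | m.support ⊆ ∅ ∧ wt u m = k} = {0} by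
        ext m
        simp only [Finset.subset_empty, Finsupp.support_eq_empty, Set.mem_ofPred_eq,
          Set.mem_singleton_iff, and_iff_left_iff_imp]
        rintro rfl
        rw [map_zero, hk]]
      simp
    · rw [show {m : Fin n →₀ ℕ | m.support ⊆ ∅ ∧ wt u m = k} = ∅ by
        ext m
        simp only [Finset.subset_empty, Finsupp.support_eq_empty, Set.mem_ofPred_eq,
          Set.mem_empty_iff_false, iff_false, not_and]
        rintro rfl
        rw [map_zero]
        exact Ne.symm hk]
      simp
  | insert a A ha ih =>
    rw [Finset.prod_insert ha, mul_comm (1 - _), mul_assoc]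
    convert ih using 2
    ext k
    rw [coeff_one_sub_single_mul, coeff_countSeries, coeff_countSeries, coeff_countSeries,
      ncard_setOf_support_subset_insert hu ha]
    push_cast
    ring

/-- The series whose `k`-th coefficient is the dimension of the space of polynomials of `u`-degree
at most `k`. -/
def cumSeries (u : Fin n → ℕ) : LaurentSeries ℤ :=
  countSeries (fun k => {m | wt u m ≤ k}) (setOf_wt_le_of_neg u)

/-- The factor `1 - t` turns the counts of degree `≤ k` into counts of degree exactly `k`. -/
theorem mul_cumSeries {u : Fin n → ℕ} (hu : ∀ i, 0 < u i) :
    (1 - single (1 : ℤ) (1 : ℤ)) * ((∏ i, (1 - single (u i : ℤ) (1 : ℤ))) * cumSeries u) = 1 := by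
  rw [mul_left_comm]
  convert prod_mul_countSeries hu Finset.univ using 2
  ext k
  rw [coeff_one_sub_single_mul, cumSeries, coeff_countSeries, coeff_countSeries,
    coeff_countSeries, sub_eq_iff_eq_add]
  norm_cast
  rw [← Set.ncard_union_eq _
    ((finite_wt_eq hu k).subset fun m hm => hm.2) (finite_wt_le hu (k - 1))]
  · congr 1
    ext m
    simp only [Finset.subset_univ, Set.mem_ofPred_eq, true_and, Set.mem_union]
    omega
  · rw [Set.disjoint_left]
    rintro m ⟨-, h1⟩ h2
    simp only [Set.mem_ofPred_eq] at h2
    omega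

theorem finite_restrictSupport {s : Set (Fin n →₀ ℕ)} (hs : s.Finite) :
    Module.Finite K (restrictSupport K s) :=
  have := hs.to_subtype
  Module.Finite.of_basis (basisRestrictSupport K s)

theorem finrank_restrictSupport (s : Set (Fin n →₀ ℕ)) :
    Module.finrank K (restrictSupport K s) = s.ncard := by
  rw [Module.finrank_eq_nat_card_basis (basisRestrictSupport K s), Nat.card_coe_set_eq]

/-- The polynomials of `u`-degree at most `k`. -/
def polyLE (K : Type*) [Field K] (u : Fin n → ℕ) (k : ℤ) : Submodule K (MvPolynomial (Fin n) K) :=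
  restrictSupport K {m | wt u m ≤ k}

theorem mem_polyLE {u : Fin n → ℕ} {k : ℤ} {p : MvPolynomial (Fin n) K} :
    p ∈ polyLE K u k ↔ ∀ m, coeff m p ≠ 0 → wt u m ≤ k := by
  rw [polyLE, mem_restrictSupport_iff]
  simp [Set.subset_def]

theorem finite_polyLE {u : Fin n → ℕ} (hu : ∀ i, 0 < u i) (k : ℤ) :
    Module.Finite K (polyLE K u k) :=
  finite_restrictSupport (finite_wt_le hu k)

theorem finrank_polyLE (u : Fin n → ℕ) (k : ℤ) :
    (Module.finrank K (polyLE K u k) : ℤ) = (cumSeries u).coeff k := by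
  rw [polyLE, finrank_restrictSupport]
  rfl

theorem mul_mem_polyLE {u : Fin n → ℕ} {j k : ℤ} {p q : MvPolynomial (Fin n) K}
    (hp : p ∈ polyLE K u j) (hq : q ∈ polyLE K u k) : p * q ∈ polyLE K u (j + k) := by
  classical
  rw [mem_polyLE] at *
  intro m hm
  rw [MvPolynomial.coeff_mul] at hm
  obtain ⟨x, hx, hne⟩ := Finset.exists_ne_zero_of_sum_ne_zero hm
  rw [← Finset.HasAntidiagonal.mem_antidiagonal.mp hx, map_add]
  exact add_le_add (hp _ (left_ne_zero_of_mul hne)) (hq _ (right_ne_zero_of_mul hne))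

theorem polyLE_mono {u : Fin n → ℕ} {j k : ℤ} (h : j ≤ k) : polyLE K u j ≤ polyLE K u k :=
  restrictSupport_mono _ fun _ hm => le_trans hm h

theorem exists_mem_polyLE (u : Fin n → ℕ) (p : MvPolynomial (Fin n) K) :
    ∃ k : ℤ, 0 ≤ k ∧ p ∈ polyLE K u k := by
  refine ⟨∑ m ∈ p.support, wt u m, Finset.sum_nonneg fun m _ => wt_nonneg u m,
    mem_polyLE.mpr fun m hm => ?_⟩
  exact Finset.single_le_sum (f := fun m => wt u m) (fun m _ => wt_nonneg u m)
    (mem_support_iff.mpr hm)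

end LogDer
end

/-! ### Dimension inequalities and the degree filtration on derivations. -/

noncomputable section
namespace LogDer

open MvPolynomial

section LinearAlgebra

variable {K E F : Type*} [Field K] [AddCommGroup E] [Module K E] [AddCommGroup F] [Module K F]

theorem finrank_map_add_finrank_inf_ker (f : E →ₗ[K] F) (V : Submodule K E) [Module.Finite K V] :
    Module.finrank K (V.map f) + Module.finrank K (V ⊓ LinearMap.ker f : Submodule K E) =
      Module.finrank K V := by
  rw [← LinearMap.finrank_range_add_finrank_ker (f.domRestrict V), LinearMap.range_domRestrict,
    LinearMap.ker_domRestrict, ← Submodule.map_comap_subtype, Submodule.finrank_map_subtype_eq]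

/-- `f` induces an injection of `V / (V ∩ f⁻¹N)` into `W / (W ∩ N)`. -/
theorem finrank_sub_finrank_inf_comap_le (f : E →ₗ[K] F) {V : Submodule K E} {W : Submodule K F}
    (N : Submodule K F) [Module.Finite K V] [Module.Finite K W] (h : V.map f ≤ W) :
    (Module.finrank K V : ℤ) - Module.finrank K (V ⊓ N.comap f : Submodule K E) ≤
      Module.finrank K W - Module.finrank K (W ⊓ N : Submodule K F) := by
  have h1 := finrank_map_add_finrank_inf_ker (N.mkQ ∘ₗ f) V
  have h2 := finrank_map_add_finrank_inf_ker N.mkQ W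
  rw [LinearMap.ker_comp, Submodule.ker_mkQ, Submodule.map_comp] at h1
  rw [Submodule.ker_mkQ] at h2
  have h3 := Submodule.finrank_mono (Submodule.map_mono (f := N.mkQ) h)
  omega

end LinearAlgebra

variable {K : Type*} [Field K] {n : ℕ}

theorem weightedHomogeneousComponent_mul_of_isWeightedHomogeneous {w : Fin n → ℤ}
    {q : MvPolynomial (Fin n) K} {d : ℤ} (hq : IsWeightedHomogeneous w q d) (j : ℤ)
    (p : MvPolynomial (Fin n) K) :
    weightedHomogeneousComponent w j (q * p) = q * weightedHomogeneousComponent w (j - d) p := by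
  ext m
  rw [coeff_weightedHomogeneousComponent, coeff_mul, coeff_mul,
    show ∀ (c : Prop) [Decidable c] (x : K), (if c then x else 0) = ite c 1 0 * x by simp,
    Finset.mul_sum]
  refine Finset.sum_congr rfl fun x hx => ?_
  rw [coeff_weightedHomogeneousComponent]
  by_cases h : coeff x.1 q = 0
  · simp [h]
  · have h1 := hq h
    rw [← Finset.HasAntidiagonal.mem_antidiagonal.mp hx, map_add, h1]
    by_cases h2 : Finsupp.weight w x.2 = j - d
    · rw [if_pos h2, if_pos (by omega), one_mul]
    · rw [if_neg h2, if_neg (by omega), zero_mul, mul_zero]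

theorem mem_polyLE_of_mul_mem {u : Fin n → ℕ} {Q : MvPolynomial (Fin n) K} (hQ0 : Q ≠ 0) {d : ℤ}
    (hQ : IsWeightedHomogeneous (fun l => (u l : ℤ)) Q d) {k : ℤ} {p : MvPolynomial (Fin n) K}
    (h : Q * p ∈ polyLE K u k) : p ∈ polyLE K u (k - d) := by
  rw [mem_polyLE] at h ⊢
  intro m hm
  by_contra! hlt
  -- The part of `Q p` in degree `wt u m + d > k` vanishes, and it is `Q` times the part of `p`
  -- containing the monomial `m`.
  have h1 := weightedHomogeneousComponent_mul_of_isWeightedHomogeneous hQ (wt u m + d) p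
  rw [add_sub_cancel_right] at h1
  have h2 : weightedHomogeneousComponent (fun l => (u l : ℤ)) (wt u m + d) (Q * p) = 0 := by
    refine weightedHomogeneousComponent_eq_zero' _ _ fun x hx he => ?_
    have := h x (mem_support_iff.mp hx)
    rw [wt, he] at this
    omega
  rw [h2, eq_comm, mul_eq_zero, or_iff_right hQ0] at h1
  have h3 := congrArg (coeff m) h1
  rw [coeff_weightedHomogeneousComponent, if_pos rfl, coeff_zero] at h3
  exact hm h3

theorem finrank_polyLE_inf_range {u : Fin n → ℕ} {Q : MvPolynomial (Fin n) K} (hQ0 : Q ≠ 0)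
    {d : ℤ} (hQ : IsWeightedHomogeneous (fun l => (u l : ℤ)) Q d) (k : ℤ) :
    (Module.finrank K
      (polyLE K u k ⊓ LinearMap.range (LinearMap.mulLeft K Q) : Submodule K _) : ℤ) =
      (cumSeries u).coeff (k - d) := by
  have hinj : Function.Injective (LinearMap.mulLeft K Q) := fun a b h => mul_left_cancel₀ hQ0 h
  have hQ' : Q ∈ polyLE K u d := mem_polyLE.mpr fun m hm => (hQ hm).le
  have h : (polyLE K u k ⊓ LinearMap.range (LinearMap.mulLeft K Q) : Submodule K _) =
      (polyLE K u (k - d)).map (LinearMap.mulLeft K Q) := by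
    ext p
    constructor
    · rintro ⟨h, g, rfl⟩
      exact ⟨g, mem_polyLE_of_mul_mem hQ0 hQ h, rfl⟩
    · rintro ⟨g, hg, rfl⟩
      refine ⟨?_, g, rfl⟩
      have := mul_mem_polyLE hQ' hg
      rwa [add_sub_cancel] at this
  rw [h, ← finrank_polyLE (K := K),
    ← (Submodule.equivMapOfInjective _ hinj (polyLE K u (k - d))).finrank_eq]

/-- The derivations `∑ a_i ∂_i` such that `a_i` is supported in the set `s i` of monomials. -/
def derSupported (K : Type*) [Field K] (s : Fin n → Set (Fin n →₀ ℕ)) : Submodule K (Der K n) where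
  carrier := {δ | ∀ i, δ (X i) ∈ restrictSupport K (s i)}
  zero_mem' := fun _ => zero_mem _
  add_mem' := fun ha hb i => add_mem (ha i) (hb i)
  smul_mem' := fun c _ ha i => Submodule.smul_mem _ c (ha i)

/-- A derivation supported in `s` is a tuple of polynomials supported in the `s i`. -/
def derSupportedEquiv (s : Fin n → Set (Fin n →₀ ℕ)) :
    derSupported K s ≃ₗ[K] Π i, restrictSupport K (s i) where
  toFun δ i := ⟨δ.1 (X i), δ.2 i⟩
  map_add' _ _ := rfl
  map_smul' _ _ := rfl
  invFun a := ⟨mkDerivation K fun i => (a i : MvPolynomial (Fin n) K), fun i => by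
    rw [mkDerivation_X]
    exact (a i).2⟩
  left_inv δ := Subtype.ext <| derivation_ext fun i => mkDerivation_X _ _ i
  right_inv a := funext fun i => Subtype.ext <| mkDerivation_X _ _ i

theorem finite_derSupported {s : Fin n → Set (Fin n →₀ ℕ)} (hs : ∀ i, (s i).Finite) :
    Module.Finite K (derSupported K s) :=
  have (i : Fin n) : Module.Finite K (restrictSupport K (s i)) := finite_restrictSupport (hs i)
  Module.Finite.equiv (derSupportedEquiv s).symm

theorem finrank_derSupported {s : Fin n → Set (Fin n →₀ ℕ)} (hs : ∀ i, (s i).Finite) :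
    Module.finrank K (derSupported K s) = ∑ i, (s i).ncard := by
  have (i : Fin n) : Module.Finite K (restrictSupport K (s i)) := finite_restrictSupport (hs i)
  rw [(derSupportedEquiv s).finrank_eq, Module.finrank_pi_fintype]
  simp_rw [finrank_restrictSupport]

/-- The derivations of `(u, v)`-degree at most `k`. -/
def derLE (K : Type*) [Field K] (u : Fin n → ℕ) (v : Fin n → ℤ) (k : ℤ) : Submodule K (Der K n) :=
  derSupported K fun i => {m | wt u m ≤ k - v i}

theorem finite_derLE {u : Fin n → ℕ} (hu : ∀ i, 0 < u i) (v : Fin n → ℤ) (k : ℤ) :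
    Module.Finite K (derLE K u v k) :=
  finite_derSupported fun _ => finite_wt_le hu _

theorem derDegree_le_derLE (u : Fin n → ℕ) (v : Fin n → ℤ) (k : ℤ) :
    derDegree u v k ≤ derLE K u v k := fun _ h i =>
  mem_polyLE.mpr fun _ hm => (h i hm).le

theorem finite_gradedPart {u : Fin n → ℕ} (hu : ∀ i, 0 < u i) (v : Fin n → ℤ)
    (M : Submodule (MvPolynomial (Fin n) K) (Der K n)) (j : ℤ) :
    Module.Finite K (gradedPart u v M j) :=
  have := finite_derLE (K := K) hu v j
  Submodule.finiteDimensional_of_le (inf_le_right.trans (derDegree_le_derLE u v j))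

theorem coeff_homPart (u : Fin n → ℕ) (v : Fin n → ℤ) (j : ℤ) (δ : Der K n) (i : Fin n)
    (m : Fin n →₀ ℕ) :
    coeff m (homPart u v j δ (X i)) = if wt u m = j - v i then coeff m (δ (X i)) else 0 := by
  rw [homPart, mkDerivation_X, coeff_weightedHomogeneousComponent]

/-- The homogeneous part of degree `j` of a derivation, as a linear map. -/
def homPartHom (u : Fin n → ℕ) (v : Fin n → ℤ) (j : ℤ) : Der K n →ₗ[K] Der K n where
  toFun := homPart u v j
  map_add' δ ε := derivation_ext fun i => by
    simp only [homPart, mkDerivation_X, Derivation.add_apply, map_add]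
  map_smul' c δ := derivation_ext fun i => by
    simp only [homPart, mkDerivation_X, Derivation.smul_apply, map_smul, RingHom.id_apply]

theorem homPart_mem_derDegree (u : Fin n → ℕ) (v : Fin n → ℤ) (j : ℤ) (δ : Der K n) :
    homPart u v j δ ∈ derDegree u v j := fun i => by
  rw [homPart, mkDerivation_X]
  exact weightedHomogeneousComponent_isWeightedHomogeneous _ _

theorem homPart_of_mem {u : Fin n → ℕ} {v : Fin n → ℤ} {j : ℤ} {δ : Der K n}
    (h : δ ∈ derDegree u v j) : homPart u v j δ = δ := derivation_ext fun i => by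
  rw [homPart, mkDerivation_X]
  exact (h i).weightedHomogeneousComponent_same

theorem homPart_smul {u : Fin n → ℕ} {v : Fin n → ℤ} {q : MvPolynomial (Fin n) K} {d : ℤ}
    (hq : IsWeightedHomogeneous (fun l => (u l : ℤ)) q d) (j : ℤ) (δ : Der K n) :
    homPart u v j (q • δ) = q • homPart u v (j - d) δ := derivation_ext fun i => by
  rw [homPart, mkDerivation_X, Derivation.smul_apply, Derivation.smul_apply, smul_eq_mul,
    smul_eq_mul, weightedHomogeneousComponent_mul_of_isWeightedHomogeneous hq, homPart,
    mkDerivation_X, sub_right_comm]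

theorem isWeightedHomogeneous_X_natCast (u : Fin n → ℕ) (a : Fin n) :
    IsWeightedHomogeneous (fun l => (u l : ℤ)) (X a : MvPolynomial (Fin n) K) (u a) :=
  isWeightedHomogeneous_X K _ a

theorem homPart_X_smul (u : Fin n → ℕ) (v : Fin n → ℤ) (a : Fin n) (j : ℤ) (δ : Der K n) :
    homPart u v j ((X a : MvPolynomial (Fin n) K) • δ) =
      (X a : MvPolynomial (Fin n) K) • homPart u v (j - u a) δ :=
  homPart_smul (isWeightedHomogeneous_X_natCast u a) j δ

theorem X_smul_mem_derDegree {u : Fin n → ℕ} {v : Fin n → ℤ} {a : Fin n} {j : ℤ} {δ : Der K n}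
    (h : δ ∈ derDegree u v (j - u a)) :
    (X a : MvPolynomial (Fin n) K) • δ ∈ derDegree u v j := fun i => by
  have := (isWeightedHomogeneous_X_natCast (K := K) u a).mul (h i)
  rwa [show (u a : ℤ) + (j - u a - v i) = j - v i by ring] at this

theorem finite_setOf_homPart_ne_zero (u : Fin n → ℕ) (v : Fin n → ℤ) (δ : Der K n) :
    {j | homPart u v j δ ≠ 0}.Finite := by
  refine (Set.finite_iUnion fun i : Fin n =>
    ((δ (X i)).support.finite_toSet.image fun m => wt u m + v i)).subset fun j hj => ?_
  by_contra hne
  refine hj (derivation_ext fun i => ?_)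
  ext m
  rw [coeff_homPart, Derivation.zero_apply, coeff_zero]
  split_ifs with h
  · by_contra hm
    exact hne (Set.mem_iUnion.mpr ⟨i, m, by simpa using hm, by simp only; omega⟩)
  · rfl

/-- The elements of `M` of `(u, v)`-degree at most `k`. -/
def filtPart (u : Fin n → ℕ) (v : Fin n → ℤ)
    (M : Submodule (MvPolynomial (Fin n) K) (Der K n)) (k : ℤ) : Submodule K (Der K n) :=
  derLE K u v k ⊓ M.restrictScalars K

theorem finite_filtPart {u : Fin n → ℕ} (hu : ∀ i, 0 < u i) (v : Fin n → ℤ)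
    (M : Submodule (MvPolynomial (Fin n) K) (Der K n)) (k : ℤ) :
    Module.Finite K (filtPart u v M k) :=
  have := finite_derLE (K := K) hu v k
  Submodule.finiteDimensional_of_le inf_le_left

theorem derLE_eq_bot (u : Fin n → ℕ) (v : Fin n → ℤ) {k : ℤ} (hk : k < -∑ i, |v i|) :
    derLE K u v k = ⊥ := by
  rw [eq_bot_iff]
  intro δ hδ
  rw [Submodule.mem_bot]
  refine derivation_ext fun i => ?_
  rw [Derivation.zero_apply]
  by_contra h
  obtain ⟨m, hm⟩ := ne_zero_iff.mp h
  have h1 := mem_polyLE.mp (hδ i) m hm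
  have h2 := wt_nonneg u m
  have h3 : |v i| ≤ ∑ i, |v i| :=
    Finset.single_le_sum (f := fun i => |v i|) (fun _ _ => abs_nonneg _) (Finset.mem_univ i)
  have h4 := neg_abs_le (v i)
  omega

/-- The series whose `k`-th coefficient is the dimension of the space of elements of `M` of
degree at most `k`. -/
def filtSeries (u : Fin n → ℕ) (v : Fin n → ℤ)
    (M : Submodule (MvPolynomial (Fin n) K) (Der K n)) : LaurentSeries ℤ :=
  HahnSeries.ofSuppBddBelow (fun j => (Module.finrank K (filtPart u v M j) : ℤ)) <| by
    refine ⟨-∑ i, |v i|, fun j hj => ?_⟩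
    by_contra! h
    refine hj ?_
    change (Module.finrank K (filtPart u v M j) : ℤ) = 0
    rw [filtPart, derLE_eq_bot u v h, bot_inf_eq, finrank_bot, Nat.cast_zero]

/-- Taking the part of degree `k` maps the elements of degree `≤ k` onto `M_k`, with kernel those of
degree `≤ k - 1`. Gradedness keeps the image inside `M`. -/
theorem one_sub_mul_filtSeries {u : Fin n → ℕ} (hu : ∀ i, 0 < u i) (v : Fin n → ℤ)
    {M : Submodule (MvPolynomial (Fin n) K) (Der K n)} (hM : IsGraded u v M) :
    (1 - HahnSeries.single (1 : ℤ) (1 : ℤ)) * filtSeries u v M = hilbertPoincare u v M := by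
  ext k
  rw [coeff_one_sub_single_mul]
  change (Module.finrank K (filtPart u v M k) : ℤ) - Module.finrank K (filtPart u v M (k - 1)) =
    Module.finrank K (gradedPart u v M k)
  have := finite_filtPart hu v M k
  rw [← finrank_map_add_finrank_inf_ker (homPartHom u v k) (filtPart u v M k)]
  have h1 : (filtPart u v M k).map (homPartHom u v k) = gradedPart u v M k := by
    ext δ
    constructor
    · rintro ⟨ε, hε, rfl⟩
      exact ⟨hM ε hε.2 k, homPart_mem_derDegree u v k ε⟩
    · intro h
      exact ⟨δ, ⟨derDegree_le_derLE u v k h.2, h.1⟩, homPart_of_mem h.2⟩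
  have h2 : (filtPart u v M k ⊓ LinearMap.ker (homPartHom u v k) : Submodule K _) =
      filtPart u v M (k - 1) := by
    ext δ
    constructor
    · rintro ⟨⟨h1, h2⟩, h3⟩
      refine ⟨fun i => mem_polyLE.mpr fun m hm => ?_, h2⟩
      have h4 := mem_polyLE.mp (h1 i) m hm
      have h5 : coeff m (homPart u v k δ (X i)) = 0 := by
        rw [show homPart u v k δ = 0 from h3, Derivation.zero_apply, coeff_zero]
      rw [coeff_homPart, ite_eq_right_iff] at h5
      have h6 : wt u m ≠ k - v i := fun h => hm (h5 h)
      omega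
    · rintro ⟨h1, h2⟩
      refine ⟨⟨fun i => polyLE_mono (by omega) (h1 i), h2⟩, ?_⟩
      refine derivation_ext fun i => ?_
      ext m
      change coeff m (homPart u v k δ (X i)) = _
      rw [coeff_homPart, Derivation.zero_apply, coeff_zero, ite_eq_right_iff]
      intro h
      by_contra hm
      have := mem_polyLE.mp (h1 i) m hm
      omega
  rw [h1, h2]
  push_cast
  ring

theorem filtSeries_top {u : Fin n → ℕ} (hu : ∀ i, 0 < u i) (v : Fin n → ℤ) :
    filtSeries u v (⊤ : Submodule (MvPolynomial (Fin n) K) (Der K n)) =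
      (∑ i, HahnSeries.single (v i) (1 : ℤ)) * cumSeries u := by
  ext k
  rw [Finset.sum_mul, HahnSeries.coeff_sum]
  simp_rw [HahnSeries.coeff_single_mul, one_mul]
  change (Module.finrank K (filtPart u v _ k) : ℤ) = ∑ i, (_ : ℤ)
  rw [filtPart, Submodule.restrictScalars_top, inf_top_eq, derLE,
    finrank_derSupported fun _ => finite_wt_le hu _]
  push_cast
  rfl

end LogDer
end

/-! ### The Hilbert–Serre theorem for subquotients of the module of derivations. -/

noncomputable section
namespace LogDer

open MvPolynomial

theorem finite_support_sub {x y : LaurentSeries ℤ} (hx : x.coeff.support.Finite)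
    (hy : y.coeff.support.Finite) : (x - y).coeff.support.Finite :=
  (hx.union hy).subset fun k hk => by
    by_contra! h
    simp only [Set.mem_union, Function.mem_support, not_or, not_not] at h
    exact hk (by rw [HahnSeries.coeff_sub, h.1, h.2, sub_zero])

theorem finite_support_single_mul (a : ℤ) {x : LaurentSeries ℤ} (hx : x.coeff.support.Finite) :
    (HahnSeries.single a (1 : ℤ) * x).coeff.support.Finite :=
  (hx.image (· + a)).subset fun k hk => by
    rw [Function.mem_support, HahnSeries.coeff_single_mul, one_mul] at hk
    exact ⟨k - a, hk, sub_add_cancel k a⟩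

variable {K : Type*} [Field K] {n : ℕ}

instance isNoetherian_der :
    IsNoetherian (MvPolynomial (Fin n) K) (Der K n) :=
  isNoetherian_of_injective
    ({ toFun := fun δ i => δ (X i)
       map_add' := fun _ _ => rfl
       map_smul' := fun _ _ => rfl } :
      Der K n →ₗ[MvPolynomial (Fin n) K] Fin n → MvPolynomial (Fin n) K)
    fun _ _ h => derivation_ext fun i => congrFun h i

theorem smul_sub_constantCoeff_smul_mem {M N : Submodule (MvPolynomial (Fin n) K) (Der K n)}
    (h : ∀ i, ∀ δ ∈ M, (X i : MvPolynomial (Fin n) K) • δ ∈ N) (p : MvPolynomial (Fin n) K)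
    {δ : Der K n} (hδ : δ ∈ M) : p • δ - constantCoeff p • δ ∈ N := by
  induction p using MvPolynomial.induction_on with
  | C a =>
    rw [constantCoeff_C, show (C a : MvPolynomial (Fin n) K) • δ = a • δ from
      algebraMap_smul (MvPolynomial (Fin n) K) a δ, sub_self]
    exact zero_mem N
  | add p q hp hq =>
    have := add_mem hp hq
    rwa [map_add, add_smul, add_smul, add_sub_add_comm]
  | mul_X p i _ =>
    rw [map_mul, constantCoeff_X, mul_zero, zero_smul, sub_zero, mul_smul]
    exact N.smul_mem p (h i δ hδ)

/-- Polynomials act on `M` modulo `N` through their constant terms, so finitely many module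
generators of `M` already span it over `K` modulo `N`. Only degrees occurring in these generators
can contribute. -/
theorem exists_finite_gradedPart_le {u : Fin n → ℕ} {v : Fin n → ℤ}
    {M N : Submodule (MvPolynomial (Fin n) K) (Der K n)} (hN : IsGraded u v N)
    (h : ∀ i, ∀ δ ∈ M, (X i : MvPolynomial (Fin n) K) • δ ∈ N) :
    ∃ J : Set ℤ, J.Finite ∧ ∀ j ∉ J, gradedPart u v M j ≤ gradedPart u v N j := by
  obtain ⟨G, hG⟩ := IsNoetherian.noetherian M
  have key (δ : Der K n) (hδ : δ ∈ M) : ∃ ε ∈ Submodule.span K (G : Set (Der K n)), δ - ε ∈ N := by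
    rw [← hG] at hδ
    induction hδ using Submodule.span_induction with
    | mem δ hδ => exact ⟨δ, Submodule.subset_span hδ, by rw [sub_self]; exact zero_mem N⟩
    | zero => exact ⟨0, zero_mem _, by rw [sub_self]; exact zero_mem N⟩
    | add δ δ' _ _ h₁ h₂ =>
      obtain ⟨ε, hε, h₁⟩ := h₁
      obtain ⟨ε', hε', h₂⟩ := h₂
      exact ⟨ε + ε', add_mem hε hε', by rw [add_sub_add_comm]; exact add_mem h₁ h₂⟩
    | smul p δ hδ h₁ =>
      obtain ⟨ε, hε, h₁⟩ := h₁
      refine ⟨constantCoeff p • ε, Submodule.smul_mem _ _ hε, ?_⟩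
      rw [hG] at hδ
      have h₂ := add_mem (smul_sub_constantCoeff_smul_mem h p hδ)
        ((N.restrictScalars K).smul_mem (constantCoeff p) h₁)
      rwa [smul_sub, sub_add_sub_cancel] at h₂
  refine ⟨⋃ δ ∈ G, {j | homPart u v j δ ≠ 0},
    G.finite_toSet.biUnion fun δ _ => finite_setOf_homPart_ne_zero u v δ, fun j hj δ hδ => ?_⟩
  refine ⟨?_, hδ.2⟩
  obtain ⟨ε, hε, hδε⟩ := key δ hδ.1
  have h₀ : homPartHom u v j ε = 0 := by
    have : Submodule.span K (G : Set (Der K n)) ≤ LinearMap.ker (homPartHom u v j) := by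
      rw [Submodule.span_le]
      intro γ hγ
      by_contra hne
      exact hj (Set.mem_biUnion hγ hne)
    exact this hε
  have h₁ := hN _ hδε j
  rwa [show homPart u v j (δ - ε) = homPart u v j δ - homPartHom u v j ε from
    map_sub (homPartHom u v j) δ ε, h₀, sub_zero, homPart_of_mem hδ.2] at h₁

theorem coeff_hilbertPoincare (u : Fin n → ℕ) (v : Fin n → ℤ)
    (M : Submodule (MvPolynomial (Fin n) K) (Der K n)) (j : ℤ) :
    (hilbertPoincare u v M).coeff j = Module.finrank K (gradedPart u v M j) := rfl

/-- The submodule `{δ ∈ M | x_a δ ∈ N}`. -/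
def colonX (a : Fin n) (M N : Submodule (MvPolynomial (Fin n) K) (Der K n)) :
    Submodule (MvPolynomial (Fin n) K) (Der K n) :=
  M ⊓ N.comap (LinearMap.lsmul _ _ (X a))

/-- The submodule `N + x_a M`. -/
def supX (a : Fin n) (M N : Submodule (MvPolynomial (Fin n) K) (Der K n)) :
    Submodule (MvPolynomial (Fin n) K) (Der K n) :=
  N ⊔ M.map (LinearMap.lsmul _ _ (X a))

theorem mem_colonX {a : Fin n} {M N : Submodule (MvPolynomial (Fin n) K) (Der K n)}
    {δ : Der K n} :
    δ ∈ colonX a M N ↔ δ ∈ M ∧ (X a : MvPolynomial (Fin n) K) • δ ∈ N := Iff.rfl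

theorem mem_supX {a : Fin n} {M N : Submodule (MvPolynomial (Fin n) K) (Der K n)}
    {δ : Der K n} :
    δ ∈ supX a M N ↔ ∃ ε ∈ N, ∃ γ ∈ M, ε + (X a : MvPolynomial (Fin n) K) • γ = δ := by
  rw [supX, Submodule.mem_sup]
  simp only [Submodule.mem_map, LinearMap.lsmul_apply, exists_exists_and_eq_and]

theorem homPart_add (u : Fin n → ℕ) (v : Fin n → ℤ) (j : ℤ) (δ ε : Der K n) :
    homPart u v j (δ + ε) = homPart u v j δ + homPart u v j ε :=
  map_add (homPartHom u v j) δ ε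

theorem IsGraded.colonX {u : Fin n → ℕ} {v : Fin n → ℤ}
    {M N : Submodule (MvPolynomial (Fin n) K) (Der K n)} (hM : IsGraded u v M)
    (hN : IsGraded u v N) (a : Fin n) : IsGraded u v (colonX a M N) := by
  intro δ hδ j
  rw [mem_colonX] at hδ ⊢
  have h := hN _ hδ.2 (j + u a)
  rw [homPart_X_smul, add_sub_cancel_right] at h
  exact ⟨hM _ hδ.1 j, h⟩

theorem IsGraded.supX {u : Fin n → ℕ} {v : Fin n → ℤ}
    {M N : Submodule (MvPolynomial (Fin n) K) (Der K n)} (hM : IsGraded u v M)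
    (hN : IsGraded u v N) (a : Fin n) : IsGraded u v (supX a M N) := by
  intro δ hδ j
  obtain ⟨ε, hε, γ, hγ, rfl⟩ := mem_supX.mp hδ
  rw [homPart_add, homPart_X_smul]
  exact mem_supX.mpr ⟨_, hN _ hε j, _, hM _ hγ _, rfl⟩

/-- Multiplication by `x_a`, followed by reduction modulo `N`, has kernel `colonX a M N` on `M` and
image `supX a M N` modulo `N`; rank–nullity is applied in one degree. -/
theorem finrank_gradedPart_supX {u : Fin n → ℕ} (hu : ∀ i, 0 < u i) {v : Fin n → ℤ}
    {M N : Submodule (MvPolynomial (Fin n) K) (Der K n)} (hM : IsGraded u v M)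
    (hN : IsGraded u v N) (a : Fin n) (j : ℤ) :
    Module.finrank K (gradedPart u v (supX a M N) j) +
        Module.finrank K (gradedPart u v (colonX a M N) (j - u a)) =
      Module.finrank K (gradedPart u v N j) +
        Module.finrank K (gradedPart u v M (j - u a)) := by
  have := finite_gradedPart hu v M (j - u a)
  have := finite_gradedPart hu v (supX a M N) j
  set π : Der K n →ₗ[K] (Der K n ⧸ N.restrictScalars K) := (N.restrictScalars K).mkQ
  set f : Der K n →ₗ[K] Der K n := Algebra.lsmul K K (Der K n) (X a : MvPolynomial (Fin n) K)
  have hf (δ : Der K n) : f δ = (X a : MvPolynomial (Fin n) K) • δ := rfl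
  have h1 := finrank_map_add_finrank_inf_ker (π ∘ₗ f) (gradedPart u v M (j - u a))
  have h2 := finrank_map_add_finrank_inf_ker π (gradedPart u v (supX a M N) j)
  have h3 : (gradedPart u v M (j - u a) ⊓ LinearMap.ker (π ∘ₗ f) : Submodule K _) =
      gradedPart u v (colonX a M N) (j - u a) := by
    rw [LinearMap.ker_comp, Submodule.ker_mkQ]
    ext δ
    exact ⟨fun h => ⟨⟨h.1.1, h.2⟩, h.1.2⟩, fun h => ⟨⟨h.1.1, h.2⟩, h.1.2⟩⟩
  have h4 : (gradedPart u v (supX a M N) j ⊓ LinearMap.ker π : Submodule K _) =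
      gradedPart u v N j := by
    rw [Submodule.ker_mkQ]
    ext δ
    refine ⟨fun h => ⟨h.2, h.1.2⟩, fun h => ⟨⟨?_, h.2⟩, h.1⟩⟩
    exact (le_sup_left : N ≤ supX a M N) h.1
  have h5 : (gradedPart u v M (j - u a)).map (π ∘ₗ f) =
      (gradedPart u v (supX a M N) j).map π := by
    ext y
    constructor
    · rintro ⟨δ, hδ, rfl⟩
      exact ⟨f δ, ⟨mem_supX.mpr ⟨0, zero_mem N, δ, hδ.1, zero_add _⟩,
        X_smul_mem_derDegree hδ.2⟩, rfl⟩
    · rintro ⟨δ, hδ, rfl⟩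
      obtain ⟨ε, hε, γ, hγ, h⟩ := mem_supX.mp hδ.1
      -- `γ` itself need not be homogeneous, but its part of degree `j - u a` has the same image,
      -- since the sum is homogeneous of degree `j`.
      refine ⟨homPart u v (j - u a) γ, ⟨hM γ hγ _, homPart_mem_derDegree u v _ γ⟩, ?_⟩
      have h6 := homPart_of_mem hδ.2
      rw [← h, homPart_add, homPart_X_smul, h] at h6
      rw [LinearMap.comp_apply, hf, ← h6, map_add]
      refine (add_eq_right.mpr ?_).symm
      exact (Submodule.Quotient.mk_eq_zero _).mpr (hN ε hε j)
  rw [h3, h5] at h1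
  rw [h4] at h2
  omega

/-- The Hilbert–Serre theorem for a subquotient `M / N` of the module of derivations which is
annihilated by the variables outside of `A`. -/
theorem finite_support_prod_mul_sub {u : Fin n → ℕ} (hu : ∀ i, 0 < u i) {v : Fin n → ℤ}
    (A : Finset (Fin n)) {M N : Submodule (MvPolynomial (Fin n) K) (Der K n)}
    (hM : IsGraded u v M) (hN : IsGraded u v N) (hNM : N ≤ M)
    (h : ∀ i ∉ A, ∀ δ ∈ M, (X i : MvPolynomial (Fin n) K) • δ ∈ N) :
    ((∏ i ∈ A, (1 - HahnSeries.single (u i : ℤ) (1 : ℤ))) *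
      (hilbertPoincare u v M - hilbertPoincare u v N)).coeff.support.Finite := by
  induction A using Finset.induction_on generalizing M N with
  | empty =>
    obtain ⟨J, hJ, hJ'⟩ := exists_finite_gradedPart_le hN fun i => h i (Finset.notMem_empty i)
    refine hJ.subset fun j hj => ?_
    by_contra hne
    refine hj ?_
    have h1 : gradedPart u v M j = gradedPart u v N j :=
      le_antisymm (hJ' j hne) (inf_le_inf_right _ fun _ h => hNM h)
    rw [Finset.prod_empty, one_mul, HahnSeries.coeff_sub, coeff_hilbertPoincare,
      coeff_hilbertPoincare, h1, sub_self]
  | insert a A ha ih =>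
    -- Multiplication by `x_a` on `M / N` has kernel `colonX a M N / N` and cokernel `M / supX a M
    -- N`. Both are annihilated by `x_a` as well, so the induction hypothesis applies to them.
    have hstep : (1 - HahnSeries.single (u a : ℤ) (1 : ℤ)) *
        (hilbertPoincare u v M - hilbertPoincare u v N) =
        (hilbertPoincare u v M - hilbertPoincare u v (supX a M N)) -
          HahnSeries.single (u a : ℤ) (1 : ℤ) *
            (hilbertPoincare u v (colonX a M N) - hilbertPoincare u v N) := by
      ext j
      rw [coeff_one_sub_single_mul]
      simp only [HahnSeries.coeff_sub, HahnSeries.coeff_single_mul, one_mul, coeff_hilbertPoincare]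
      have := finrank_gradedPart_supX hu hM hN a j
      omega
    rw [Finset.prod_insert ha, mul_comm (1 - _), mul_assoc, hstep, mul_sub, mul_left_comm]
    refine finite_support_sub (ih hM (hM.supX hN a) ?_ ?_)
      (finite_support_single_mul _ (ih (hM.colonX hN a) hN ?_ ?_))
    · intro δ hδ
      obtain ⟨ε, hε, γ, hγ, rfl⟩ := mem_supX.mp hδ
      exact add_mem (hNM hε) (M.smul_mem _ hγ)
    · intro i hi δ hδ
      rw [mem_supX]
      by_cases hia : i = a
      · exact ⟨0, zero_mem N, δ, hδ, by rw [hia, zero_add]⟩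
      · exact ⟨_, h i (by simp [hia, hi]) δ hδ, 0, zero_mem M, by rw [smul_zero, add_zero]⟩
    · exact fun δ hδ => mem_colonX.mpr ⟨hNM hδ, N.smul_mem _ hδ⟩
    · intro i hi δ hδ
      by_cases hia : i = a
      · exact hia ▸ (mem_colonX.mp hδ).2
      · exact h i (by simp [hia, hi]) δ (mem_colonX.mp hδ).1

theorem finite_support_hilbertNumerator {u : Fin n → ℕ} (hu : ∀ i, 0 < u i) {v : Fin n → ℤ}
    {M : Submodule (MvPolynomial (Fin n) K) (Der K n)} (hM : IsGraded u v M) :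
    (hilbertNumerator u v M).coeff.support.Finite := by
  have hbot : IsGraded u v (⊥ : Submodule (MvPolynomial (Fin n) K) (Der K n)) := by
    intro δ hδ j
    rw [Submodule.mem_bot] at hδ ⊢
    rw [hδ]
    exact map_zero (homPartHom u v j)
  have h := finite_support_prod_mul_sub hu Finset.univ hM hbot bot_le
    fun i hi => absurd (Finset.mem_univ i) hi
  have h0 : hilbertPoincare u v (⊥ : Submodule (MvPolynomial (Fin n) K) (Der K n)) = 0 := by
    ext j
    rw [coeff_hilbertPoincare, gradedPart, Submodule.restrictScalars_bot, bot_inf_eq, finrank_bot,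
      Nat.cast_zero, HahnSeries.coeff_zero]
  rwa [h0, sub_zero] at h

end LogDer
end

/-! ### The logarithmic derivations as the preimage of the ideal `(Q)`. -/

noncomputable section
namespace LogDer

open MvPolynomial

variable {K : Type*} [Field K] {n : ℕ}

/-- For a variable `x_i` occurring in `p`, the derivative is nonzero in characteristic zero and has
smaller degree in `x_i` than `p`. -/
theorem exists_not_dvd_pderiv [CharZero K] {p : MvPolynomial (Fin n) K} (hp : Irreducible p) :
    ∃ i, ¬ p ∣ pderiv i p := by
  have hvars : p.vars.Nonempty := by
    by_contra h
    have hC := vars_eq_empty_iff_eq_C.mp (Finset.not_nonempty_iff_eq_empty.mp h)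
    have hc : p.coeff 0 ≠ 0 := fun h0 => hp.ne_zero (by rw [hC, h0, C_0])
    exact hp.not_isUnit (hC ▸ (IsUnit.mk0 _ hc).map C)
  obtain ⟨i, hi⟩ := hvars
  obtain ⟨m, hm, hmi⟩ := (mem_vars_iff_mem_support i).mp hi
  rw [Finsupp.mem_support_iff] at hmi
  refine ⟨i, fun ⟨g, hg⟩ => ?_⟩
  have hne : pderiv i p ≠ 0 := by
    refine ne_zero_iff.mpr ⟨m - Finsupp.single i 1, ?_⟩
    rw [coeff_pderiv, Finsupp.sub_add_single_one_cancel hmi]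
    exact mul_ne_zero (mem_support_iff.mp hm) (Nat.cast_add_one_ne_zero _)
  have hg0 : g ≠ 0 := fun h => hne (by rw [hg, h, mul_zero])
  have hpos : 0 < degreeOf i p := (Nat.pos_of_ne_zero hmi).trans_le (monomial_le_degreeOf i hm)
  have hlt : degreeOf i (pderiv i p) < degreeOf i p := by
    rw [degreeOf_lt_iff hpos]
    intro x hx
    rw [mem_support_iff, coeff_pderiv] at hx
    have := monomial_le_degreeOf i (mem_support_iff.mpr (left_ne_zero_of_mul hx))
    simpa using this
  rw [hg, degreeOf_mul_eq hp.ne_zero hg0] at hlt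
  omega

theorem exists_finset_irreducible_factors {R : Type*} [CommRing R] [IsDomain R]
    [UniqueFactorizationMonoid R] {Q : R} (hQ : Q ≠ 0) :
    ∃ F : Finset R, (∀ p ∈ F, Irreducible p ∧ p ∣ Q) ∧
      (∀ p ∈ F, ∀ q ∈ F, p ∣ q → p = q) ∧
      ∀ p, Irreducible p → p ∣ Q → ∃ q ∈ F, Associated p q := by
  classical
  let _ : NormalizationMonoid R := Nonempty.some inferInstance
  refine ⟨(UniqueFactorizationMonoid.normalizedFactors Q).toFinset, fun p hp => ?_,
    fun p hp q hq hpq => ?_, fun p hp hpQ => ?_⟩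
  · rw [Multiset.mem_toFinset] at hp
    exact ⟨UniqueFactorizationMonoid.irreducible_of_normalized_factor p hp,
      UniqueFactorizationMonoid.dvd_of_mem_normalizedFactors hp⟩
  · rw [Multiset.mem_toFinset] at hp hq
    have hp' := UniqueFactorizationMonoid.irreducible_of_normalized_factor p hp
    have hq' := UniqueFactorizationMonoid.irreducible_of_normalized_factor q hq
    rw [← UniqueFactorizationMonoid.normalize_normalized_factor p hp,
      ← UniqueFactorizationMonoid.normalize_normalized_factor q hq]
    exact normalize_eq_normalize_iff_associated.mpr (hp'.associated_of_dvd hq' hpq)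
  · obtain ⟨q, hq, h⟩ := UniqueFactorizationMonoid.exists_mem_normalizedFactors_of_dvd hQ hp hpQ
    exact ⟨q, Multiset.mem_toFinset.mpr hq, h⟩

/-- Evaluation of derivations at a polynomial. -/
def derEval (p : MvPolynomial (Fin n) K) :
    Der K n →ₗ[MvPolynomial (Fin n) K] MvPolynomial (Fin n) K where
  toFun δ := δ p
  map_add' _ _ := rfl
  map_smul' _ _ := rfl

theorem mem_logDerPow {p : MvPolynomial (Fin n) K} {k : ℕ} {δ : Der K n} :
    δ ∈ logDerPow p k ↔ p ^ k ∣ δ p :=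
  ⟨fun ⟨h, e⟩ => ⟨h, by rw [e, mul_comm]⟩, fun ⟨h, e⟩ => ⟨h, by rw [e, mul_comm]⟩⟩

/-- Associated polynomials differ by a constant, which derivations pull out. -/
theorem dvd_derivation_of_associated {p q : MvPolynomial (Fin n) K} (h : Associated p q) {k : ℕ}
    {δ : Der K n} (hq : q ^ k ∣ δ q) : p ^ k ∣ δ p := by
  obtain ⟨w, rfl⟩ := h.symm
  obtain ⟨c, -, hc⟩ := isUnit_iff_eq_C_of_isReduced.mp w.isUnit
  rw [Derivation.leibniz, hc, derivation_C, smul_zero, zero_add, mul_pow, ← hc, smul_eq_mul]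
  exact ((w.isUnit.pow k).mul_right_dvd.mpr hq).mul_left _

theorem mem_logDer {Q : MvPolynomial (Fin n) K} {δ : Der K n} :
    δ ∈ logDer Q ↔ ∀ p, Irreducible p → p ∣ Q → p ^ multiplicity p Q ∣ δ p := by
  simp only [logDer, Submodule.mem_iInf, mem_logDerPow]

/-- `logDer Q` is the preimage of the ideal `(Q)` under a linear map that attains values relatively
prime to `Q`. -/
theorem exists_linearMap_mem_logDer_iff [CharZero K] {Q : MvPolynomial (Fin n) K} (hQ : Q ≠ 0) :
    ∃ Ψ : Der K n →ₗ[MvPolynomial (Fin n) K] MvPolynomial (Fin n) K,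
      (∀ δ, δ ∈ logDer Q ↔ Q ∣ Ψ δ) ∧ ∃ θ, IsRelPrime Q (Ψ θ) := by
  classical
  obtain ⟨F, hF, hFF, hFQ⟩ := exists_finset_irreducible_factors hQ
  have hc (p : MvPolynomial (Fin n) K) :
      ∃ c, p ∈ F → Q = p ^ multiplicity p Q * c ∧ ¬ p ∣ c := by
    by_cases hp : p ∈ F
    · have hfin : FiniteMultiplicity p Q :=
        FiniteMultiplicity.of_not_isUnit (hF p hp).1.not_isUnit hQ
      obtain ⟨c, h1, h2⟩ := hfin.exists_eq_pow_mul_and_not_dvd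
      exact ⟨c, fun _ => ⟨h1, h2⟩⟩
    · exact ⟨0, fun h => absurd h hp⟩
  choose c hc using hc
  -- `c p` is the cofactor `Q / p ^ e_p`, so it is divisible by `q ^ e_q` for every other factor
  -- `q`.
  set Ψ : Der K n →ₗ[MvPolynomial (Fin n) K] MvPolynomial (Fin n) K :=
    ∑ p ∈ F, c p • derEval p
  have hΨ (δ : Der K n) : Ψ δ = ∑ p ∈ F, c p * δ p := by
    simp only [Ψ, LinearMap.sum_apply, LinearMap.smul_apply, smul_eq_mul]
    rfl
  have hcop {p q : MvPolynomial (Fin n) K} (hp : p ∈ F) (hq : q ∈ F) (hpq : q ≠ p) :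
      p ^ multiplicity p Q ∣ c q := by
    have h1 : IsRelPrime p q :=
      (hF p hp).1.isRelPrime_iff_not_dvd.mpr fun h => hpq (hFF p hp q hq h).symm
    have h2 : p ^ multiplicity p Q ∣ q ^ multiplicity q Q * c q :=
      (hc q hq).1 ▸ pow_multiplicity_dvd p Q
    exact (h1.pow (m := multiplicity p Q) (n := multiplicity q Q)).dvd_of_dvd_mul_left h2
  have hmod {p : MvPolynomial (Fin n) K} (hp : p ∈ F) (δ : Der K n) :
      p ^ multiplicity p Q ∣ Ψ δ - c p * δ p := by
    rw [hΨ, ← Finset.add_sum_erase F _ hp, add_sub_cancel_left]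
    exact Finset.dvd_sum fun q hq =>
      (hcop hp (Finset.mem_of_mem_erase hq) (Finset.ne_of_mem_erase hq)).mul_right _
  refine ⟨Ψ, fun δ => ⟨fun h => ?_, fun h => ?_⟩, ?_⟩
  · rw [hΨ]
    refine Finset.dvd_sum fun p hp => ?_
    conv_lhs => rw [(hc p hp).1, mul_comm]
    exact mul_dvd_mul_left _ (mem_logDer.mp h p (hF p hp).1 (hF p hp).2)
  · refine mem_logDer.mpr fun p hp hpQ => ?_
    obtain ⟨q, hq, hpq⟩ := hFQ p hp hpQ
    rw [multiplicity_eq_of_associated_left hpq.symm]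
    refine dvd_derivation_of_associated hpq ?_
    refine (hF q hq).1.prime.pow_dvd_of_dvd_mul_left _ (hc q hq).2 ?_
    exact (dvd_sub_right ((pow_multiplicity_dvd q Q).trans h)).mp (hmod hq δ)
  · have hdvd {p : MvPolynomial (Fin n) K} (hp : p ∈ F) {δ : Der K n} (h : p ∣ Ψ δ) :
        p ∣ δ p := by
      have h0 : multiplicity p Q ≠ 0 := fun h0 => by
        have := (hc p hp).1
        rw [h0, pow_zero, one_mul] at this
        exact (hc p hp).2 (this ▸ (hF p hp).2)
      have h1 : p ∣ c p * δ p := (dvd_sub_right h).mp ((dvd_pow_self p h0).trans (hmod hp δ))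
      exact ((hF p hp).1.prime.dvd_or_dvd h1).resolve_left (hc p hp).2
    -- `V p` collects the derivations with `p ∣ Ψ δ`. Each is a proper subspace, as it misses some
    -- `∂_i`, and finitely many proper subspaces cannot cover a vector space over the infinite field
    -- `K`; any `θ` outside all of them works.
    let V (p : MvPolynomial (Fin n) K) : Subspace K (Der K n) :=
      (Submodule.comap Ψ (Ideal.span {p})).restrictScalars K
    have hV : ⋃ W ∈ F.image V, (W : Set (Der K n)) ≠ Set.univ := by
      refine Subspace.biUnion_ne_univ_of_top_notMem fun h => ?_
      obtain ⟨p, hp, hpV⟩ := Finset.mem_image.mp h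
      obtain ⟨i, hi⟩ := exists_not_dvd_pderiv (hF p hp).1
      refine hi (hdvd hp (Ideal.mem_span_singleton.mp ?_))
      have : pderiv i ∈ V p := hpV ▸ Submodule.mem_top
      exact this
    obtain ⟨θ, hθ⟩ := (Set.ne_univ_iff_exists_notMem _).mp hV
    refine ⟨θ, WfDvdMonoid.isRelPrime_of_no_irreducible_factors (fun h => hQ h.1) ?_⟩
    intro p hp hpQ hpθ
    obtain ⟨q, hq, hpq⟩ := hFQ p hp hpQ
    refine hθ (Set.mem_biUnion (Finset.mem_coe.mpr (Finset.mem_image_of_mem V hq)) ?_)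
    exact Ideal.mem_span_singleton.mpr (hpq.symm.dvd.trans hpθ)

end LogDer
end

/-! ### Comparison of `Der/D(Q)` with `S/QS` and the value of `χ`. -/

noncomputable section
namespace LogDer

open MvPolynomial

variable {K : Type*} [Field K] {n : ℕ}

theorem derivation_eq_sum (δ : Der K n) : δ = ∑ i, δ (X i) • (pderiv i : Der K n) := by
  classical
  refine derivation_ext fun j => ?_
  rw [← Derivation.coeFnAddMonoidHom_apply (∑ i, _), map_sum, Finset.sum_apply,
    Finset.sum_eq_single j]
  · simp
  · intro i _ hi
    simp [pderiv_X_of_ne hi.symm]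
  · exact fun h => absurd (Finset.mem_univ j) h

theorem exists_map_derLE_le (u : Fin n → ℕ) (v : Fin n → ℤ)
    (Ψ : Der K n →ₗ[MvPolynomial (Fin n) K] MvPolynomial (Fin n) K) :
    ∃ c : ℤ, ∀ k, (derLE K u v k).map (Ψ.restrictScalars K) ≤ polyLE K u (k + c) := by
  choose e he0 he using fun i => exists_mem_polyLE u (Ψ (pderiv i))
  refine ⟨∑ i, (e i + |v i|), fun k => ?_⟩
  rintro _ ⟨δ, hδ, rfl⟩
  rw [LinearMap.restrictScalars_apply, derivation_eq_sum δ, map_sum]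
  refine sum_mem fun i _ => ?_
  rw [map_smul, smul_eq_mul]
  refine polyLE_mono ?_ (mul_mem_polyLE (hδ i) (he i))
  have h1 := Finset.single_le_sum (f := fun i => e i + |v i|)
    (fun i _ => add_nonneg (he0 i) (abs_nonneg _)) (Finset.mem_univ i)
  have h2 := neg_abs_le (v i)
  omega

theorem exists_map_polyLE_le (u : Fin n → ℕ) (v : Fin n → ℤ) (θ : Der K n) :
    ∃ c : ℤ, ∀ k, (polyLE K u (k - c)).map
      ((LinearMap.toSpanSingleton (MvPolynomial (Fin n) K) _ θ).restrictScalars K) ≤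
        derLE K u v k := by
  choose e he0 he using fun i => exists_mem_polyLE u (θ (X i))
  refine ⟨∑ i, (e i + |v i|), fun k => ?_⟩
  rintro _ ⟨p, hp, rfl⟩
  intro i
  refine polyLE_mono ?_ (mul_mem_polyLE hp (he i))
  have h1 := Finset.single_le_sum (f := fun i => e i + |v i|)
    (fun i _ => add_nonneg (he0 i) (abs_nonneg _)) (Finset.mem_univ i)
  have h2 := le_abs_self (v i)
  omega

theorem coeff_filtSeries (u : Fin n → ℕ) (v : Fin n → ℤ)
    (M : Submodule (MvPolynomial (Fin n) K) (Der K n)) (k : ℤ) :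
    (filtSeries u v M).coeff k = Module.finrank K (filtPart u v M k) := rfl

theorem coeff_filtSeries_top (u : Fin n → ℕ) (v : Fin n → ℤ) (k : ℤ) :
    (filtSeries u v (⊤ : Submodule (MvPolynomial (Fin n) K) (Der K n))).coeff k =
      Module.finrank K (derLE K u v k) := by
  rw [coeff_filtSeries, filtPart, Submodule.restrictScalars_top, inf_top_eq]

theorem mem_range_mulLeft {Q p : MvPolynomial (Fin n) K} :
    p ∈ LinearMap.range (LinearMap.mulLeft K Q) ↔ Q ∣ p :=
  ⟨fun ⟨g, h⟩ => ⟨g, h.symm⟩, fun ⟨g, h⟩ => ⟨g, h.symm⟩⟩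

theorem exists_coeff_filtSeries_bounds [CharZero K] {u : Fin n → ℕ} (hu : ∀ i, 0 < u i)
    (v : Fin n → ℤ) {Q : MvPolynomial (Fin n) K} (hQ0 : Q ≠ 0) {d : ℤ}
    (hQ : IsWeightedHomogeneous (fun l => (u l : ℤ)) Q d) :
    ∃ a b : ℤ, ∀ k,
      (cumSeries u).coeff (k - a) - (cumSeries u).coeff (k - a - d) ≤
        (filtSeries u v (⊤ : Submodule (MvPolynomial (Fin n) K) (Der K n))).coeff k -
          (filtSeries u v (logDer Q)).coeff k ∧
      (filtSeries u v (⊤ : Submodule (MvPolynomial (Fin n) K) (Der K n))).coeff k -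
          (filtSeries u v (logDer Q)).coeff k ≤
        (cumSeries u).coeff (k + b) - (cumSeries u).coeff (k + b - d) := by
  obtain ⟨Ψ, hΨ, θ, hθ⟩ := exists_linearMap_mem_logDer_iff hQ0
  obtain ⟨a, ha⟩ := exists_map_polyLE_le u v θ
  obtain ⟨b, hb⟩ := exists_map_derLE_le u v Ψ
  refine ⟨a, b, fun k => ⟨?_, ?_⟩⟩
  · have := finite_polyLE (K := K) hu (k - a)
    have := finite_derLE (K := K) hu v k
    have h := finrank_sub_finrank_inf_comap_le _ ((logDer Q).restrictScalars K) (ha k)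
    rw [show ((logDer Q).restrictScalars K).comap
        ((LinearMap.toSpanSingleton (MvPolynomial (Fin n) K) _ θ).restrictScalars K) =
        LinearMap.range (LinearMap.mulLeft K Q) from ?_,
      finrank_polyLE_inf_range hQ0 hQ, finrank_polyLE, ← coeff_filtSeries_top] at h
    · exact h
    · ext p
      rw [mem_range_mulLeft]
      change p • θ ∈ logDer Q ↔ _
      rw [hΨ, map_smul, smul_eq_mul]
      -- Relative primeness of `Q` and `Ψ θ` makes `p ↦ p θ` injective from `S/QS` to `Der/D(Q)`.
      exact ⟨hθ.dvd_of_dvd_mul_right, fun h => h.mul_right _⟩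
  · have := finite_polyLE (K := K) hu (k + b)
    have := finite_derLE (K := K) hu v k
    have h := finrank_sub_finrank_inf_comap_le _ (LinearMap.range (LinearMap.mulLeft K Q)) (hb k)
    rw [show (LinearMap.range (LinearMap.mulLeft K Q)).comap (Ψ.restrictScalars K) =
        (logDer Q).restrictScalars K from ?_,
      finrank_polyLE_inf_range hQ0 hQ, finrank_polyLE, ← coeff_filtSeries_top] at h
    · exact h
    · ext δ
      rw [Submodule.mem_comap, mem_range_mulLeft]
      exact (hΨ δ).symm

/-- The coefficient of the derivative at `j` is `j + 1` times the original one at `j + 1`, hence the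
reindexing by `1`. -/
theorem chi_eq_finsum (u : Fin n → ℕ) (v : Fin n → ℤ)
    (M : Submodule (MvPolynomial (Fin n) K) (Der K n)) :
    chi u v M = ∑ᶠ j : ℤ, j * (hilbertNumerator u v M).coeff j := by
  rw [chi, ← finsum_comp_equiv (Equiv.addRight (1 : ℤ))
    (f := fun j : ℤ => j * (hilbertNumerator u v M).coeff j)]
  refine finsum_congr fun j => ?_
  rw [LaurentSeries.derivative_apply, LaurentSeries.hasseDeriv_coeff]
  simp

/-- Clears denominators in the difference between the filtered series of `Der/M` and that of `S/QS`
shifted by `a`, as required by `HasValues.nonneg`. -/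
theorem prod_mul_sub_eq {u : Fin n → ℕ} (hu : ∀ i, 0 < u i) (v : Fin n → ℤ)
    {M : Submodule (MvPolynomial (Fin n) K) (Der K n)} (hM : IsGraded u v M) (a d : ℤ) :
    (1 - HahnSeries.single (1 : ℤ) (1 : ℤ)) *
        ((∏ i, (1 - HahnSeries.single (u i : ℤ) (1 : ℤ))) *
          (filtSeries u v (⊤ : Submodule (MvPolynomial (Fin n) K) (Der K n)) -
            filtSeries u v M -
            HahnSeries.single a 1 * ((1 - HahnSeries.single d 1) * cumSeries u))) =
      ∑ i, HahnSeries.single (v i) (1 : ℤ) - hilbertNumerator u v M -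
        (HahnSeries.single a 1 - HahnSeries.single (a + d) 1) := by
  have h1 := mul_cumSeries hu
  have h2 := one_sub_mul_filtSeries hu v hM
  have h3 : HahnSeries.single (a + d) (1 : ℤ) = HahnSeries.single a 1 * HahnSeries.single d 1 := by
    rw [HahnSeries.single_mul_single, mul_one]
  rw [filtSeries_top (K := K) hu, hilbertNumerator, ← h2, h3]
  linear_combination (∑ i, HahnSeries.single (v i) (1 : ℤ) -
    HahnSeries.single a 1 * (1 - HahnSeries.single d 1)) * h1

theorem chi_logDer [CharZero K] {u : Fin n → ℕ} (hu : ∀ i, 0 < u i) {v : Fin n → ℤ}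
    {Q : MvPolynomial (Fin n) K} (hQ0 : Q ≠ 0) {d : ℤ}
    (hQ : IsWeightedHomogeneous (fun l => (u l : ℤ)) Q d) (hgr : IsGraded u v (logDer Q)) :
    chi u v (logDer Q) = d + ∑ i, v i := by
  obtain ⟨a, b, hab⟩ := exists_coeff_filtSeries_bounds hu v hQ0 hQ
  have hN := hasValues_of_finite_support (finite_support_hilbertNumerator hu hgr)
  rw [← chi_eq_finsum] at hN
  have hF := HasValues.sum Finset.univ fun i (_ : i ∈ Finset.univ) => hasValues_single (v i) 1
  have hw (a : ℤ) := (hF.sub hN).sub ((hasValues_single a 1).sub (hasValues_single (a + d) 1))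
  have hu' (i : Fin n) : (0 : ℤ) < u i := by exact_mod_cast hu i
  have hlow := HasValues.nonneg (fun i => (u i : ℤ)) hu' (fun k => ?_)
    (prod_mul_sub_eq hu v hgr a d) (hw a)
  · have hupp := HasValues.nonneg (fun i => (u i : ℤ)) hu'
      (x := -(filtSeries u v (⊤ : Submodule (MvPolynomial (Fin n) K) (Der K n)) -
        filtSeries u v (logDer Q) -
        HahnSeries.single (-b) 1 * ((1 - HahnSeries.single d 1) * cumSeries u))) (fun k => ?_)
      (by rw [mul_neg, mul_neg, prod_mul_sub_eq hu v hgr (-b) d]) (hw (-b)).neg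
    -- The value at `t = 1` does not depend on the shift, so the two sign conditions make it `0`.
    -- The derivative, `|v| - χ + d` for either shift, is then both `≤ 0` and `≥ 0`.
    · simp only [mul_one] at hlow hupp
      have h1 := hlow.1
      have h2 := hupp.1
      have h3 := hlow.2 (by omega)
      have h4 := hupp.2 (by omega)
      linarith
    · have := (hab k).2
      simp only [HahnSeries.coeff_neg, HahnSeries.coeff_sub, HahnSeries.coeff_single_mul,
        coeff_one_sub_single_mul, one_mul, sub_neg_eq_add]
      linarith
  · have := (hab k).1
    simp only [HahnSeries.coeff_sub, HahnSeries.coeff_single_mul, coeff_one_sub_single_mul,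
      one_mul]
    linarith

end LogDer
end

theorem mainTheorem2 {K : Type*} [Field K] [CharZero K] {n : ℕ}
    (u : Fin n → ℕ) (hu : ∀ i, 0 < u i) (v : Fin n → ℤ)
    (Q : MvPolynomial (Fin n) K) (hQ0 : Q ≠ 0)
    (d : ℕ) (hQ : MvPolynomial.IsWeightedHomogeneous u Q d)
    (hgr : LogDer.IsGraded u v (LogDer.logDer Q)) :
    (∀ j : ℤ, Module.Finite K (LogDer.gradedPart u v (LogDer.logDer Q) j)) ∧
    (LogDer.hilbertNumerator u v (LogDer.logDer Q)).coeff.support.Finite ∧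
    LogDer.chi u v (LogDer.logDer Q) = (d : ℤ) + ∑ i, v i := by
  refine ⟨LogDer.finite_gradedPart hu v _, LogDer.finite_support_hilbertNumerator hu hgr,
    LogDer.chi_logDer hu hQ0 (fun m hm => ?_) hgr⟩
  rw [LogDer.wt_eq u m, hQ hm]
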